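/- Let $L\in\mathbb{R}^{n\times n}$ be symmetric and positive semidefinite, let $0<\alpha<1$ and $u_0\in\mathbb{R}^n$. Consider functions $u:[0,\infty)\to\mathbb{R}^n$ that are continuous on $[0,\infty)$ and continuously differentiable on $(0,\infty)$, with $u(0)=u_0$. For such $u$, the Volterra equation $$u'(t)+\int_0^t K_S(t-s)\,L\,u(s)\,ds=0\quad(t>0),\qquad K_S(t)=\frac{t^{\alpha-2}}{\Gamma(\alpha-1)},$$ is equivalent to the Caputo equation $$D_t^\alpha u(t)=-L\,u(t)\quad(t>0),\qquad D_t^\alpha u(t)=\frac{1}{\Gamma(1-\alpha)}\int_0^t\frac{u'(\tau)}{(t-\tau)^{\alpha}}\,d\tau .$$ Here, since $K_S$ is not integrable at $0$, the integral in the Volterra equation is the Hadamard finite part, that is, the constant term $I(t)\in\mathbb{R}^n$ in the expansion $\int_0^{t-\varepsilon}K_S(t-s)Lu(s)\,ds=\varepsilon^{\alpha-1}c(t)+I(t)+o(1)$ as $\varepsilon\to0^+$, for some $c(t)\in\mathbb{R}^n$; the Caputo equation includes the absolute convergence of the integral that defines $D_t^\alpha u(t)$ for every $t>0$. Moreover,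 each of the two equations has exactly one solution in this class with $u(0)=u_0$, namely $$u(t)=E_\alpha(-t^\alpha L)\,u_0\quad(t\ge0),\qquad E_\alpha(M)=\sum_{k=0}^\infty\frac{M^k}{\Gamma(\alpha k+1)},$$ where the series converges for $M=-t^\alpha L$, $t\ge0$. -/

import Mathlib

open Set Filter Topology MeasureTheory

namespace Subdiffusion

/-- The kernel `K_S(t) = t ^ (α - 2) / Γ(α - 1)`, used for `t > 0` only. -/
noncomputable def kernelS (α t : ℝ) : ℝ :=
  t ^ (α - 2) / Real.Gamma (α - 1)

/-- `I` is the Hadamard finite part of the integral `∫₀ᵗ f(s) ds`, where `f` has a singularity of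
type `(t - s) ^ (-(1 + p))`, `p > 0`, at the upper end point: as `ε → 0⁺`,
`∫₀^{t-ε} f(s) ds = ε ^ (-p) c + I + o(1)` for some coefficient `c`. Since `ε ^ (-p) → ∞`, both
`c` and `I` are determined by `f`; if `f` is integrable on `(0, t)`, then `c = 0` and `I` is the
ordinary integral. -/
def HasFinitePart {E : Type*} [NormedAddCommGroup E] [NormedSpace ℝ E]
    (p : ℝ) (f : ℝ → E) (t : ℝ) (I : E) : Prop :=
  (∀ ε ∈ Ioo 0 t, IntervalIntegrable f volume 0 (t - ε)) ∧
    ∃ c : E, Tendsto (fun ε : ℝ => (∫ s in (0 : ℝ)..(t - ε), f s) - ε ^ (-p) • c)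
      (𝓝[>] 0) (𝓝 I)

/-- Regularity of a classical solution: continuous on `[0, ∞)` and continuously differentiable on
`(0, ∞)`. Values at negative times play no role. -/
def IsRegular {n : ℕ} (u : ℝ → Fin n → ℝ) : Prop :=
  ContinuousOn u (Ici 0) ∧ ContDiffOn ℝ 1 u (Ioi 0)

/-- The Volterra equation `u'(t) + ∫₀ᵗ K_S(t - s) L u(s) ds = 0` for all `t > 0`. The kernel
`K_S` is not integrable at `0`, and the integral is the Hadamard finite part. -/
def SolvesVolterra {n : ℕ} (α : ℝ) (L : Matrix (Fin n) (Fin n) ℝ) (u : ℝ → Fin n → ℝ) : Prop :=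
  ∀ t : ℝ, 0 < t → ∃ I : Fin n → ℝ,
    HasFinitePart (1 - α) (fun s => kernelS α (t - s) • L.mulVec (u s)) t I ∧
      deriv u t + I = 0

/-- The Caputo derivative
`D_t^α u(t) = (1 / Γ(1 - α)) ∫₀ᵗ (t - τ) ^ (-α) u'(τ) dτ`. -/
noncomputable def caputoDeriv {E : Type*} [NormedAddCommGroup E] [NormedSpace ℝ E]
    (α : ℝ) (u : ℝ → E) (t : ℝ) : E :=
  (1 / Real.Gamma (1 - α)) • ∫ τ in (0 : ℝ)..t, (t - τ) ^ (-α) • deriv u τ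

/-- The Caputo equation `D_t^α u(t) = - L u(t)` for all `t > 0`; the integral in the Caputo
derivative is required to converge. -/
def SolvesCaputo {n : ℕ} (α : ℝ) (L : Matrix (Fin n) (Fin n) ℝ) (u : ℝ → Fin n → ℝ) : Prop :=
  ∀ t : ℝ, 0 < t →
    IntervalIntegrable (fun τ => (t - τ) ^ (-α) • deriv u τ) volume 0 t ∧
      caputoDeriv α u t = -(L.mulVec (u t))

/-- The `k`-th term `M ^ k / Γ(α k + 1)` of the Mittag-Leffler series. -/
noncomputable def mittagLefflerTerm {n : ℕ} (α : ℝ) (M : Matrix (Fin n) (Fin n) ℝ) (k : ℕ) :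
    Matrix (Fin n) (Fin n) ℝ :=
  (1 / Real.Gamma (α * k + 1)) • M ^ k

/-- The matrix Mittag-Leffler function `E_α(M) = ∑ₖ M ^ k / Γ(α k + 1)`. -/
noncomputable def mittagLeffler {n : ℕ} (α : ℝ) (M : Matrix (Fin n) (Fin n) ℝ) :
    Matrix (Fin n) (Fin n) ℝ :=
  ∑' k : ℕ, mittagLefflerTerm α M k

/-- `t ↦ E_α(-t^α L) u₀`. -/
noncomputable def mittagLefflerFlow {n : ℕ} (α : ℝ) (L : Matrix (Fin n) (Fin n) ℝ)
    (u₀ : Fin n → ℝ) (t : ℝ) : Fin n → ℝ :=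
  (mittagLeffler α (-(t ^ α • L))).mulVec u₀

end Subdiffusion

/-! Write $J^\beta$ for the Riemann-Liouville integral, that is, convolution with
$x^{\beta-1}/\Gamma(\beta)$ on $(0,t)$, and $A$ for the operator of $L$. Both equations are compared
with the weakly singular integrated equation $u = u_0 - J^\alpha A u$.

Volterra: since $\Gamma(\alpha) = (\alpha-1)\Gamma(\alpha-1)$, the kernel $K_S$ is the derivative of
the kernel of $J^\alpha$, and the finite part of $K_S * f$ is exactly $(J^\alpha f)'$
(`exists_hasDerivAt_fracInt_and_hasFinitePart`). The Volterra equation thus says $(u + J^\alpha A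
u)' = 0$, and $J^\alpha A u \to 0$ at $0^+$ fixes the constant.

Caputo: $D_t^\alpha u = J^{1-\alpha} u'$. Applying $J^\alpha$ and the semigroup law $J^\alpha
J^{1-\alpha} = J^1$ (`fracInt_fracInt`, from Euler's beta integral) gives the integrated equation.

The integrated equation has at most one continuous solution: iterating it bounds the difference of
two solutions by the terms of a convergent Mittag-Leffler series (`eq_zero_of_eq_fracInt`). The flow
$E_\alpha(-t^\alpha A)u_0$ is handled through series $\sum_k t^{\alpha k+\gamma-1}/\Gamma(\alpha
k+\gamma)\,v_k$, on which $J^\beta$ merely replaces $\gamma$ by $\gamma+\beta$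
(`fracInt_fracSeries`). The step from Volterra to Caputo goes through uniqueness: the solution is
the flow, and the flow solves the Caputo equation. -/

namespace Subdiffusion

section

/-! ### Riemann-Liouville kernels and the beta integral -/

/-- The Riemann-Liouville kernel `x ^ (β - 1) / Γ(β)`. -/
noncomputable def fracKernel (β x : ℝ) : ℝ :=
  x ^ (β - 1) / Real.Gamma β

theorem fracKernel_nonneg {β x : ℝ} (hβ : 0 < β) (hx : 0 ≤ x) : 0 ≤ fracKernel β x :=
  div_nonneg (Real.rpow_nonneg hx _) (Real.Gamma_pos_of_pos hβ).le

theorem fracKernel_pos {β x : ℝ} (hβ : 0 < β) (hx : 0 < x) : 0 < fracKernel β x :=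
  div_pos (Real.rpow_pos_of_pos hx _) (Real.Gamma_pos_of_pos hβ)

@[simp]
theorem fracKernel_one (x : ℝ) : fracKernel 1 x = 1 := by
  simp [fracKernel]

theorem measurable_fracKernel (β : ℝ) : Measurable (fracKernel β) := by
  unfold fracKernel
  fun_prop

theorem continuousAt_fracKernel (β : ℝ) {x : ℝ} (hx : 0 < x) :
    ContinuousAt (fracKernel β) x :=
  (Real.continuousAt_rpow_const x _ (Or.inl hx.ne')).div_const _

/-- The semigroup law of the Riemann-Liouville kernels, that is, Euler's beta integral. -/
theorem integral_fracKernel_mul_fracKernel {β γ t : ℝ} (hβ : 0 < β) (hγ : 0 < γ) (ht : 0 < t) :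
    ∫ s in (0 : ℝ)..t, fracKernel β (t - s) * fracKernel γ s = fracKernel (γ + β) t := by
  have h1 := Complex.betaIntegral_scaled γ β ht
  have h2 := Complex.betaIntegral_eq_Gamma_mul_div γ β (by simpa using hγ) (by simpa using hβ)
  have h3 : ∫ s in (0 : ℝ)..t, s ^ (γ - 1) * (t - s) ^ (β - 1) =
      t ^ (γ + β - 1) * (Real.Gamma γ * Real.Gamma β / Real.Gamma (γ + β)) := by
    have h4 : ∫ s in (0 : ℝ)..t, (s : ℂ) ^ ((γ : ℂ) - 1) * ((t : ℂ) - s) ^ ((β : ℂ) - 1) =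
        ∫ s in (0 : ℝ)..t, ((s ^ (γ - 1) * (t - s) ^ (β - 1) : ℝ) : ℂ) := by
      refine intervalIntegral.integral_congr fun s hs => ?_
      rw [uIcc_of_le ht.le] at hs
      simp only [Complex.ofReal_mul, Complex.ofReal_cpow hs.1,
        Complex.ofReal_cpow (sub_nonneg.2 hs.2)]
      push_cast
      rfl
    rw [h4, intervalIntegral.integral_ofReal, h2] at h1
    have h5 : ((t : ℂ) ^ ((γ : ℂ) + β - 1)) = ((t ^ (γ + β - 1) : ℝ) : ℂ) := by
      rw [Complex.ofReal_cpow ht.le]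
      push_cast
      rfl
    rw [h5, Complex.Gamma_ofReal, Complex.Gamma_ofReal, ← Complex.ofReal_add,
      Complex.Gamma_ofReal] at h1
    exact_mod_cast h1
  have h6 : ∀ s, fracKernel β (t - s) * fracKernel γ s =
      (Real.Gamma β * Real.Gamma γ)⁻¹ * (s ^ (γ - 1) * (t - s) ^ (β - 1)) := fun s => by
    simp only [fracKernel, div_eq_mul_inv, mul_inv]
    ring
  simp_rw [h6]
  rw [intervalIntegral.integral_const_mul, h3, fracKernel]
  have := (Real.Gamma_pos_of_pos hβ).ne'
  have := (Real.Gamma_pos_of_pos hγ).ne'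
  have := (Real.Gamma_pos_of_pos (add_pos hγ hβ)).ne'
  field_simp

theorem intervalIntegrable_fracKernel_mul_fracKernel {β γ t : ℝ} (hβ : 0 < β) (hγ : 0 < γ)
    (ht : 0 < t) :
    IntervalIntegrable (fun s => fracKernel β (t - s) * fracKernel γ s) volume 0 t := by
  -- The integral of a non-integrable function is $0$ by convention, so the positive value of the
  -- beta integral already proves integrability.
  refine intervalIntegral.intervalIntegrable_of_integral_ne_zero ?_
  rw [integral_fracKernel_mul_fracKernel hβ hγ ht]
  exact (fracKernel_pos (add_pos hγ hβ) ht).ne'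

theorem intervalIntegrable_fracKernel {β : ℝ} (hβ : 0 < β) (a b : ℝ) :
    IntervalIntegrable (fracKernel β) volume a b :=
  (intervalIntegral.intervalIntegrable_rpow' (by linarith)).div_const _

theorem intervalIntegrable_fracKernel_sub {β : ℝ} (hβ : 0 < β) (t a b : ℝ) :
    IntervalIntegrable (fun s => fracKernel β (t - s)) volume a b := by
  have := (intervalIntegrable_fracKernel hβ (t - a) (t - b)).comp_sub_left t
  simpa using this

/-! ### Growth of Gamma and convergence of Mittag-Leffler series -/

/-- Keep only $x > A$ in the Gamma integral, where $x^{s-1} \ge A^{s-1}$. As $A$ is free, Gamma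
outgrows every exponential. -/
theorem rpow_mul_exp_le_Gamma {A s : ℝ} (hA : 0 < A) (hs : 1 ≤ s) :
    A ^ (s - 1) * Real.exp (-A) ≤ Real.Gamma s := by
  have hs0 : 0 < s := by linarith
  have hint := Real.GammaIntegral_convergent hs0
  rw [Real.Gamma_eq_integral hs0, ← integral_exp_neg_Ioi A, ← integral_const_mul]
  refine le_trans ?_ (setIntegral_mono_set hint ?_ (Ioi_subset_Ioi hA.le).eventuallyLE)
  · refine setIntegral_mono_on ((integrableOn_exp_neg_Ioi A).const_mul _)
      (hint.mono_set (Ioi_subset_Ioi hA.le)) measurableSet_Ioi fun x hx => ?_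
    rw [mul_comm]
    gcongr
    exact (mem_Ioi.1 hx).le
  · filter_upwards [ae_restrict_mem measurableSet_Ioi] with x hx
    exact mul_nonneg (Real.exp_pos _).le (Real.rpow_nonneg (mem_Ioi.1 hx).le _)

theorem summable_pow_div_Gamma {α γ r : ℝ} (hα : 0 < α) (hr : 0 ≤ r) :
    Summable fun k : ℕ => r ^ k / Real.Gamma (α * k + γ) := by
  -- Any $q > r$ would do. Choosing $A$ with $A^\alpha = q$ makes $(r/q)^k$, up to a constant, a
  -- majorant once $\alpha k + \gamma \ge 1$.
  set q : ℝ := 2 * r + 1 with hq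
  have hq0 : 0 < q := by positivity
  set A : ℝ := q ^ (1 / α) with hAdef
  have hA : 0 < A := Real.rpow_pos_of_pos hq0 _
  have hAα : A ^ α = q := by
    rw [hAdef, ← Real.rpow_mul hq0.le, one_div, inv_mul_cancel₀ hα.ne', Real.rpow_one]
  have hgeo : Summable fun k : ℕ => (r / q) ^ k :=
    summable_geometric_of_lt_one (by positivity) ((div_lt_one hq0).2 (by linarith))
  refine Summable.of_norm_bounded_eventually_nat
    (hgeo.mul_left (A ^ (γ - 1) * Real.exp (-A))⁻¹) ?_
  have hev : ∀ᶠ k : ℕ in atTop, 1 ≤ α * k + γ :=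
    (tendsto_atTop_add_const_right _ γ
      (tendsto_natCast_atTop_atTop.const_mul_atTop hα)).eventually_ge_atTop 1
  filter_upwards [hev] with k hk
  have hG := rpow_mul_exp_le_Gamma hA hk
  have hsplit : A ^ (α * k + γ - 1) = q ^ k * A ^ (γ - 1) := by
    rw [add_sub_assoc, Real.rpow_add hA, Real.rpow_mul hA.le, hAα, Real.rpow_natCast]
  rw [hsplit] at hG
  have hpos : 0 < q ^ k * A ^ (γ - 1) * Real.exp (-A) := by positivity
  rw [Real.norm_of_nonneg (div_nonneg (by positivity) (hpos.le.trans hG))]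
  calc r ^ k / Real.Gamma (α * k + γ) ≤ r ^ k / (q ^ k * A ^ (γ - 1) * Real.exp (-A)) := by
        gcongr
    _ = (A ^ (γ - 1) * Real.exp (-A))⁻¹ * (r / q) ^ k := by
        rw [div_pow]
        field_simp

/-! ### Fractional power series and their fractional integrals -/

/-- The Riemann-Liouville integral of order `β`. -/
noncomputable def fracInt {E : Type*} [NormedAddCommGroup E] [NormedSpace ℝ E]
    (β : ℝ) (f : ℝ → E) (t : ℝ) : E :=
  ∫ s in (0 : ℝ)..t, fracKernel β (t - s) • f s

/-- The fractional power series `∑ₖ t ^ (α k + γ - 1) / Γ(α k + γ) vₖ`. -/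
noncomputable def fracSeries {E : Type*} [NormedAddCommGroup E] [NormedSpace ℝ E]
    (α γ : ℝ) (v : ℕ → E) (t : ℝ) : E :=
  ∑' k : ℕ, fracKernel (α * k + γ) t • v k

/-- The entire series in `t ^ α` that remains of `fracSeries` when `t ^ (γ - 1)` is taken out. -/
noncomputable def reducedSeries {E : Type*} [NormedAddCommGroup E] [NormedSpace ℝ E]
    (α γ : ℝ) (v : ℕ → E) (t : ℝ) : E :=
  ∑' k : ℕ, ((t ^ α) ^ k / Real.Gamma (α * k + γ)) • v k

variable {E : Type*} [NormedAddCommGroup E] [NormedSpace ℝ E]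

theorem fracKernel_mul_add {α γ t : ℝ} (ht : 0 < t) (k : ℕ) :
    fracKernel (α * k + γ) t = t ^ (γ - 1) * ((t ^ α) ^ k / Real.Gamma (α * k + γ)) := by
  rw [fracKernel, add_sub_assoc, Real.rpow_add ht, Real.rpow_mul ht.le, Real.rpow_natCast]
  ring

theorem fracSeries_eq_rpow_smul {α γ t : ℝ} (ht : 0 < t) (v : ℕ → E) :
    fracSeries α γ v t = t ^ (γ - 1) • reducedSeries α γ v t := by
  simp only [fracSeries, reducedSeries, fracKernel_mul_add ht, mul_smul]
  rw [tsum_const_smul'']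

theorem norm_reducedSeries_term_le {α γ C M T t : ℝ} (hα : 0 < α) (hγ : 0 < γ)
    {v : ℕ → E} (hv : ∀ k, ‖v k‖ ≤ C * M ^ k) (ht : 0 ≤ t) (htT : t ≤ T) (k : ℕ) :
    ‖((t ^ α) ^ k / Real.Gamma (α * k + γ)) • v k‖ ≤
      C * ((M * T ^ α) ^ k / Real.Gamma (α * k + γ)) := by
  have hG : 0 < Real.Gamma (α * k + γ) := Real.Gamma_pos_of_pos (by positivity)
  have hT : 0 ≤ T := ht.trans htT
  rw [norm_smul, Real.norm_of_nonneg (by positivity)]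
  calc (t ^ α) ^ k / Real.Gamma (α * k + γ) * ‖v k‖
      ≤ (T ^ α) ^ k / Real.Gamma (α * k + γ) * (C * M ^ k) := by
        gcongr
        exact hv k
    _ = C * ((M * T ^ α) ^ k / Real.Gamma (α * k + γ)) := by
        rw [mul_pow]
        ring

theorem summable_reducedSeries_bound {α γ C M T : ℝ} (hα : 0 < α) (hM : 0 ≤ M) (hT : 0 ≤ T) :
    Summable fun k : ℕ => C * ((M * T ^ α) ^ k / Real.Gamma (α * k + γ)) :=
  (summable_pow_div_Gamma hα (by positivity)).mul_left C

theorem summable_norm_fracSeries {α γ C M t : ℝ} (hα : 0 < α) (hγ : 0 < γ) (hM : 0 ≤ M)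
    {v : ℕ → E} (hv : ∀ k, ‖v k‖ ≤ C * M ^ k) (ht : 0 < t) :
    Summable fun k : ℕ => ‖fracKernel (α * k + γ) t • v k‖ := by
  have h : Summable fun k : ℕ => ‖((t ^ α) ^ k / Real.Gamma (α * k + γ)) • v k‖ :=
    Summable.of_nonneg_of_le (fun _ => norm_nonneg _)
      (norm_reducedSeries_term_le hα hγ hv ht.le le_rfl) (summable_reducedSeries_bound hα hM ht.le)
  simpa only [fracKernel_mul_add ht, mul_smul, norm_smul] using h.mul_left ‖t ^ (γ - 1)‖

/-- Once $t^{\gamma-1}$ is taken out, the rest is bounded on $[0,T]$. The kernel of order $\gamma$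
is therefore an integrable majorant up to the singularity at $0$. -/
theorem exists_norm_fracSeries_le {α γ C M : ℝ} (hα : 0 < α) (hγ : 0 < γ) (hM : 0 ≤ M)
    {v : ℕ → E} (hv : ∀ k, ‖v k‖ ≤ C * M ^ k) {T : ℝ} (hT : 0 ≤ T) :
    ∃ B : ℝ, ∀ t ∈ Ioc 0 T, ‖fracSeries α γ v t‖ ≤ B * fracKernel γ t := by
  have hG := Real.Gamma_pos_of_pos hγ
  refine ⟨(∑' k : ℕ, C * ((M * T ^ α) ^ k / Real.Gamma (α * k + γ))) * Real.Gamma γ,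
    fun t ht => ?_⟩
  have h : ‖reducedSeries α γ v t‖ ≤ ∑' k : ℕ, C * ((M * T ^ α) ^ k / Real.Gamma (α * k + γ)) :=
    tsum_of_norm_bounded (summable_reducedSeries_bound hα hM hT).hasSum
      (norm_reducedSeries_term_le hα hγ hv ht.1.le ht.2)
  have ht0 := Real.rpow_nonneg ht.1.le (γ - 1)
  rw [fracSeries_eq_rpow_smul ht.1, norm_smul, Real.norm_of_nonneg ht0, fracKernel, mul_assoc,
    mul_div_cancel₀ _ hG.ne', mul_comm]
  exact mul_le_mul_of_nonneg_right h ht0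

theorem continuousOn_reducedSeries [CompleteSpace E]
    {α γ C M : ℝ} (hα : 0 < α) (hγ : 0 < γ) (hM : 0 ≤ M)
    {v : ℕ → E} (hv : ∀ k, ‖v k‖ ≤ C * M ^ k) :
    ContinuousOn (reducedSeries α γ v) (Ici 0) := by
  intro t ht
  have hT : (0 : ℝ) ≤ t + 1 := by linarith [mem_Ici.1 ht]
  have h : ContinuousOn (reducedSeries α γ v) (Icc 0 (t + 1)) :=
    continuousOn_tsum
      (fun k => ((((Real.continuous_rpow_const hα.le).pow k).div_const _).smul
        continuous_const).continuousOn)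
      (summable_reducedSeries_bound hα hM hT)
      fun k x hx => norm_reducedSeries_term_le hα hγ hv hx.1 hx.2 k
  refine (h t ⟨ht, by linarith⟩).mono_of_mem_nhdsWithin ?_
  rw [← Ici_inter_Iic]
  exact inter_mem_nhdsWithin _ (Iic_mem_nhds (by linarith))

theorem continuousOn_fracSeries [CompleteSpace E]
    {α γ C M : ℝ} (hα : 0 < α) (hγ : 0 < γ) (hM : 0 ≤ M)
    {v : ℕ → E} (hv : ∀ k, ‖v k‖ ≤ C * M ^ k) :
    ContinuousOn (fracSeries α γ v) (Ioi 0) := by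
  have h : ContinuousOn (fun t => t ^ (γ - 1) • reducedSeries α γ v t) (Ioi (0 : ℝ)) :=
    ContinuousOn.smul
      (fun t ht => (Real.continuousAt_rpow_const t _ (Or.inl (ne_of_gt ht))).continuousWithinAt)
      ((continuousOn_reducedSeries hα hγ hM hv).mono Ioi_subset_Ici_self)
  exact h.congr fun t ht => fracSeries_eq_rpow_smul ht v

theorem intervalIntegrable_fracKernel_smul_fracSeries [CompleteSpace E]
    {α β γ C M : ℝ} (hα : 0 < α) (hβ : 0 < β)
    (hγ : 0 < γ) (hM : 0 ≤ M) {v : ℕ → E} (hv : ∀ k, ‖v k‖ ≤ C * M ^ k) {t : ℝ} (ht : 0 < t) :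
    IntervalIntegrable (fun s => fracKernel β (t - s) • fracSeries α γ v s) volume 0 t := by
  obtain ⟨B, hB⟩ := exists_norm_fracSeries_le hα hγ hM hv ht.le
  refine ((intervalIntegrable_fracKernel_mul_fracKernel hβ hγ ht).const_mul B).mono_fun ?_ ?_
  · rw [uIoc_of_le ht.le]
    refine AEStronglyMeasurable.smul
      ((measurable_fracKernel β).comp (measurable_const.sub measurable_id)).aestronglyMeasurable ?_
    exact ((continuousOn_fracSeries hα hγ hM hv).mono
      Ioc_subset_Ioi_self).aestronglyMeasurable measurableSet_Ioc
  · rw [uIoc_of_le ht.le]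
    filter_upwards [ae_restrict_mem measurableSet_Ioc] with s hs
    have h1 := fracKernel_nonneg hβ (sub_nonneg.2 hs.2)
    rw [norm_smul, Real.norm_of_nonneg h1]
    calc fracKernel β (t - s) * ‖fracSeries α γ v s‖
        ≤ fracKernel β (t - s) * (B * fracKernel γ s) := by
          gcongr
          exact hB s hs
      _ = B * (fracKernel β (t - s) * fracKernel γ s) := by ring
      _ ≤ _ := le_abs_self _

/-- Fractional integrals of fractional power series are taken term by term. -/
theorem fracInt_fracSeries [CompleteSpace E] {α β γ C M : ℝ} (hα : 0 < α) (hβ : 0 < β)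
    (hγ : 0 < γ) (hM : 0 ≤ M) {v : ℕ → E} (hv : ∀ k, ‖v k‖ ≤ C * M ^ k) {t : ℝ} (ht : 0 < t) :
    fracInt β (fracSeries α γ v) t = fracSeries α (γ + β) v t := by
  have hγk : ∀ k : ℕ, 0 < α * k + γ := fun k => by positivity
  have hint : ∀ k : ℕ, ∫ s in (0 : ℝ)..t, fracKernel β (t - s) * fracKernel (α * k + γ) s =
      fracKernel (α * k + (γ + β)) t := fun k => by
    rw [integral_fracKernel_mul_fracKernel hβ (hγk k) ht, add_assoc]
  have hF : ∀ k : ℕ, Integrable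
      (fun s => (fracKernel β (t - s) * fracKernel (α * k + γ) s) • v k)
      (volume.restrict (Ioc 0 t)) := fun k =>
    ((intervalIntegrable_iff_integrableOn_Ioc_of_le ht.le).1
      (intervalIntegrable_fracKernel_mul_fracKernel hβ (hγk k) ht)).smul_const _
  -- The kernels are nonnegative, so the $L^1$ norms are the norms of the terms of the target
  -- series, whose summability is what the interchange needs.
  have hnorm : ∀ k : ℕ,
      ∫ s in Ioc 0 t, ‖(fracKernel β (t - s) * fracKernel (α * k + γ) s) • v k‖ =
        ‖fracKernel (α * k + (γ + β)) t • v k‖ := fun k => by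
    rw [norm_smul, Real.norm_of_nonneg (fracKernel_nonneg (by positivity) ht.le), ← hint k,
      intervalIntegral.integral_of_le ht.le, ← integral_mul_const]
    refine setIntegral_congr_fun measurableSet_Ioc fun s hs => ?_
    simp only [norm_smul]
    rw [Real.norm_of_nonneg (mul_nonneg (fracKernel_nonneg hβ (sub_nonneg.2 hs.2))
      (fracKernel_nonneg (hγk k) hs.1.le))]
  have hsum := hasSum_integral_of_summable_integral_norm hF (by
    simpa only [hnorm] using summable_norm_fracSeries hα (add_pos hγ hβ) hM hv ht)
  rw [fracInt, intervalIntegral.integral_of_le ht.le]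
  have hterm : ∀ s, ∑' k : ℕ, (fracKernel β (t - s) * fracKernel (α * k + γ) s) • v k =
      fracKernel β (t - s) • fracSeries α γ v s := fun s => by
    simp only [mul_smul, fracSeries]
    rw [tsum_const_smul'']
  simp only [hterm] at hsum
  rw [← hsum.tsum_eq, fracSeries]
  refine tsum_congr fun k => ?_
  rw [integral_smul_const, ← intervalIntegral.integral_of_le ht.le, hint k]

/-! ### Semigroup law and uniqueness for the Abel equation -/

theorem norm_fracInt_le {β γ t W : ℝ} (hβ : 0 < β) (hγ : 0 < γ) (ht : 0 < t) {f : ℝ → E}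
    (hf : ∀ s ∈ Ioc 0 t, ‖f s‖ ≤ W * fracKernel γ s) :
    ‖fracInt β f t‖ ≤ W * fracKernel (γ + β) t := by
  rw [← integral_fracKernel_mul_fracKernel hβ hγ ht, ← intervalIntegral.integral_const_mul]
  refine intervalIntegral.norm_integral_le_of_norm_le ht.le ?_
    ((intervalIntegrable_fracKernel_mul_fracKernel hβ hγ ht).const_mul W)
  refine Eventually.of_forall fun s hs => ?_
  have h1 := fracKernel_nonneg hβ (sub_nonneg.2 hs.2)
  rw [norm_smul, Real.norm_of_nonneg h1]
  calc fracKernel β (t - s) * ‖f s‖ ≤ fracKernel β (t - s) * (W * fracKernel γ s) := by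
        gcongr
        exact hf s hs
    _ = _ := by ring

/-- The semigroup law of the Riemann-Liouville integrals. -/
theorem fracInt_fracInt [CompleteSpace E]
    {β γ t : ℝ} (hβ : 0 < β) (hγ : 0 < γ) (ht : 0 < t) {g : ℝ → E}
    (hg : AEStronglyMeasurable g (volume.restrict (Ioo 0 t)))
    (hint : IntegrableOn (fun τ => fracKernel (γ + β) (t - τ) • g τ) (Ioo 0 t)) :
    fracInt β (fracInt γ g) t = fracInt (γ + β) g t := by
  -- The triangle $\tau \le s$ is encoded by extending the inner kernel by zero, so that Fubini
  -- applies on a square.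
  set k : ℝ → ℝ → ℝ := fun s τ => fracKernel β (t - s) * (Ici 0).indicator (fracKernel γ) (s - τ)
    with hk
  have hk_ind : ∀ τ, (fun s => k s τ) =
      (Ici τ).indicator fun s => fracKernel β (t - s) * fracKernel γ (s - τ) := fun τ => by
    ext s
    by_cases hs : τ ≤ s
    · simp [hk, hs]
    · simp [hk, hs]
  have hk_nonneg : ∀ s ∈ Ioo 0 t, ∀ τ, 0 ≤ k s τ := fun s hs τ =>
    mul_nonneg (fracKernel_nonneg hβ (by linarith [hs.2]))
      (indicator_nonneg (fun x hx => fracKernel_nonneg hγ hx) _)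
  have hk_meas : Measurable (Function.uncurry k) :=
    ((measurable_fracKernel β).comp (measurable_const.sub measurable_fst)).mul
      (((measurable_fracKernel γ).indicator measurableSet_Ici).comp
        (measurable_fst.sub measurable_snd))
  have hset : ∀ τ ∈ Ioo 0 t, Ioo 0 t ∩ Ici τ = Ico τ t := fun τ hτ => by
    ext s
    simp only [mem_inter_iff, mem_Ioo, mem_Ici, mem_Ico]
    constructor
    · rintro ⟨⟨_, h⟩, h'⟩
      exact ⟨h', h⟩
    · rintro ⟨h, h'⟩
      exact ⟨⟨hτ.1.trans_le h, h'⟩, h⟩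
  have hk_int : ∀ τ ∈ Ioo 0 t, ∫ s in Ioo 0 t, k s τ = fracKernel (γ + β) (t - τ) := fun τ hτ => by
    rw [hk_ind, setIntegral_indicator measurableSet_Ici, hset τ hτ, integral_Ico_eq_integral_Ioc,
      ← intervalIntegral.integral_of_le hτ.2.le,
      ← integral_fracKernel_mul_fracKernel hβ hγ (sub_pos.2 hτ.2)]
    have := intervalIntegral.integral_comp_sub_right (a := τ) (b := t)
      (fun r => fracKernel β (t - τ - r) * fracKernel γ r) τ
    simpa using this
  have hk_integrable : ∀ τ ∈ Ioo 0 t, IntegrableOn (fun s => k s τ) (Ioo 0 t) := fun τ hτ => by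
    refine Integrable.of_integral_ne_zero ?_
    rw [hk_int τ hτ]
    exact (fracKernel_pos (by positivity) (sub_pos.2 hτ.2)).ne'
  -- Tonelli: integrating the norm over $s$ first yields the kernel of order $\gamma+\beta$ times
  -- $\|g(\tau)\|$, integrable by `hint`.
  have hprod : Integrable (Function.uncurry fun s τ => k s τ • g τ)
      ((volume.restrict (Ioo 0 t)).prod (volume.restrict (Ioo 0 t))) := by
    refine (integrable_prod_iff' (hk_meas.aestronglyMeasurable.smul hg.comp_snd)).2 ⟨?_, ?_⟩
    · filter_upwards [ae_restrict_mem measurableSet_Ioo] with τ hτ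
      exact Integrable.smul_const (hk_integrable τ hτ) (g τ)
    · refine hint.norm.congr ?_
      filter_upwards [ae_restrict_mem measurableSet_Ioo] with τ hτ
      rw [norm_smul, Real.norm_of_nonneg (fracKernel_nonneg (by positivity) (by linarith [hτ.2])),
        ← hk_int τ hτ, ← integral_mul_const]
      refine setIntegral_congr_fun measurableSet_Ioo fun s hs => ?_
      change k s τ * ‖g τ‖ = ‖k s τ • g τ‖
      rw [norm_smul, Real.norm_of_nonneg (hk_nonneg s hs τ)]
  have hswap := integral_integral_swap hprod
  have hl : fracInt β (fracInt γ g) t = ∫ s in Ioo 0 t, ∫ τ in Ioo 0 t, k s τ • g τ := by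
    rw [fracInt, intervalIntegral.integral_of_le ht.le, integral_Ioc_eq_integral_Ioo]
    refine setIntegral_congr_fun measurableSet_Ioo fun s hs => ?_
    have h1 : ∀ τ, k s τ • g τ = fracKernel β (t - s) •
        (Iic s).indicator (fun τ => fracKernel γ (s - τ) • g τ) τ := fun τ => by
      by_cases hτ : τ ≤ s
      · simp [hk, hτ, mul_smul]
      · simp [hk, hτ]
    have h2 : Ioo 0 t ∩ Iic s = Ioc 0 s := by
      ext τ
      simp only [mem_inter_iff, mem_Ioo, mem_Iic, mem_Ioc]
      exact ⟨fun h => ⟨h.1.1, h.2⟩, fun h => ⟨⟨h.1, h.2.trans_lt hs.2⟩, h.2⟩⟩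
    simp only [h1]
    rw [integral_smul, setIntegral_indicator measurableSet_Iic, h2,
      ← intervalIntegral.integral_of_le hs.1.le, fracInt]
  have hr : fracInt (γ + β) g t = ∫ τ in Ioo 0 t, ∫ s in Ioo 0 t, k s τ • g τ := by
    rw [fracInt, intervalIntegral.integral_of_le ht.le, integral_Ioc_eq_integral_Ioo]
    refine setIntegral_congr_fun measurableSet_Ioo fun τ hτ => ?_
    rw [integral_smul_const, hk_int τ hτ]
  rw [hl, hr, hswap]

/-- The homogeneous linear Abel equation of the second kind has only the zero solution. -/
theorem eq_zero_of_eq_fracInt {α : ℝ} (hα : 0 < α) (B : E →L[ℝ] E) {w : ℝ → E}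
    (hw : ContinuousOn w (Ici 0)) (h : ∀ t, 0 < t → w t = fracInt α (fun s => B (w s)) t)
    {t : ℝ} (ht : 0 < t) : w t = 0 := by
  obtain ⟨W, hW⟩ := isCompact_Icc.exists_bound_of_continuousOn
    (hw.mono (Icc_subset_Ici_self : Icc 0 t ⊆ Ici 0))
  -- Each use of the equation gains a factor $\|B\|$ and raises the order of the majorant kernel by
  -- $\alpha$.
  have hiter : ∀ k : ℕ, ∀ s ∈ Ioc 0 t, ‖w s‖ ≤ ‖B‖ ^ k * W * fracKernel (α * k + 1) s := by
    intro k
    induction k with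
    | zero =>
      intro s hs
      simpa using hW s ⟨hs.1.le, hs.2⟩
    | succ k ih =>
      intro s hs
      rw [h s hs.1]
      have := norm_fracInt_le (W := ‖B‖ ^ (k + 1) * W) hα (by positivity : 0 < α * k + 1) hs.1
        (f := fun s => B (w s)) fun r hr => ?_
      · convert this using 3
        push_cast
        ring
      · refine (B.le_opNorm _).trans ?_
        rw [pow_succ', mul_assoc, mul_assoc, ← mul_assoc (‖B‖ ^ k)]
        gcongr
        exact ih r ⟨hr.1, hr.2.trans hs.2⟩
  have hsum : Summable fun k : ℕ => W * ((‖B‖ * t ^ α) ^ k / Real.Gamma (α * k + 1)) :=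
    summable_reducedSeries_bound hα (norm_nonneg B) ht.le
  have hle : ∀ k : ℕ, ‖w t‖ ≤ W * ((‖B‖ * t ^ α) ^ k / Real.Gamma (α * k + 1)) := fun k => by
    refine (hiter k t ⟨ht, le_rfl⟩).trans_eq ?_
    rw [fracKernel_mul_add ht, sub_self, Real.rpow_zero, mul_pow]
    ring
  exact norm_le_zero_iff.1 (ge_of_tendsto' hsum.tendsto_atTop_zero hle)

/-! ### The singular kernel and derivatives of fractional integrals -/

theorem hasDerivAt_fracKernel {α x : ℝ} (hα : α ≠ 1) (hx : 0 < x) :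
    HasDerivAt (fracKernel α) (kernelS α x) x := by
  have h := (Real.hasDerivAt_rpow_const (x := x) (p := α - 1) (Or.inl hx.ne')).div_const
    (Real.Gamma α)
  have hα' : α - 1 ≠ 0 := sub_ne_zero.2 hα
  have hG : Real.Gamma α = (α - 1) * Real.Gamma (α - 1) := by
    have := Real.Gamma_add_one hα'
    rwa [sub_add_cancel] at this
  refine h.congr_deriv ?_
  rw [kernelS, hG, mul_div_mul_left _ _ hα']
  ring_nf

theorem mul_kernelS {α x : ℝ} (hα : α ≠ 1) (hx : 0 < x) :
    x * kernelS α x = (α - 1) * fracKernel α x := by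
  have hα' : α - 1 ≠ 0 := sub_ne_zero.2 hα
  have hG : Real.Gamma α = (α - 1) * Real.Gamma (α - 1) := by
    have := Real.Gamma_add_one hα'
    rwa [sub_add_cancel] at this
  have hx' : x ^ (α - 1) = x * x ^ (α - 2) := by
    rw [← Real.rpow_one_add' hx.le (by intro h; apply hα'; linarith)]
    ring_nf
  rw [kernelS, fracKernel, hG, hx', ← mul_div_assoc, ← mul_div_assoc, mul_div_mul_left _ _ hα']

theorem measurable_kernelS (α : ℝ) : Measurable (kernelS α) := by
  unfold kernelS
  fun_prop

theorem continuousAt_kernelS (α : ℝ) {x : ℝ} (hx : 0 < x) : ContinuousAt (kernelS α) x :=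
  (Real.continuousAt_rpow_const x _ (Or.inl hx.ne')).div_const _

theorem abs_kernelS_le {α x y : ℝ} (hα : α < 1) (hx : 0 < x) (hxy : x ≤ y) :
    |kernelS α y| ≤ |kernelS α x| := by
  have hy := hx.trans_le hxy
  rw [kernelS, kernelS, abs_div, abs_div, abs_of_pos (Real.rpow_pos_of_pos hx _),
    abs_of_pos (Real.rpow_pos_of_pos hy _)]
  gcongr ?_ / _
  exact Real.rpow_le_rpow_of_nonpos hx hxy (by linarith)

theorem continuousOn_kernelS_sub_smul {α t a b : ℝ} (hbt : b < t) {f : ℝ → E}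
    (hf : ContinuousOn f (Icc a b)) :
    ContinuousOn (fun s => kernelS α (t - s) • f s) (Icc a b) := by
  refine ContinuousOn.smul (fun s hs => ?_) hf
  exact ((continuousAt_kernelS α (sub_pos.2 (hs.2.trans_lt hbt))).comp
    (continuousAt_const.sub continuousAt_id)).continuousWithinAt

/-- Differentiation under the integral when the kernel stays away from its singularity. -/
theorem hasDerivAt_integral_fracKernel_sub {α a t : ℝ} (hα : α < 1) (ha : 0 ≤ a) (hat : a < t)
    {f : ℝ → E} (hf : ContinuousOn f (Icc 0 a)) :
    HasDerivAt (fun x => ∫ s in (0 : ℝ)..a, fracKernel α (x - s) • f s)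
      (∫ s in (0 : ℝ)..a, kernelS α (t - s) • f s) t := by
  -- For $x > m$ and $s \le a$ the argument $x - s$ stays above $m - a > 0$, which gives a bound
  -- uniform in $x$.
  set m : ℝ := (a + t) / 2 with hm
  have ham : a < m := by linarith
  have hmt : m < t := by linarith
  have hfi : IntervalIntegrable f volume 0 a := hf.intervalIntegrable_of_Icc ha
  have hfm : AEStronglyMeasurable f (volume.restrict (uIoc 0 a)) := by
    rw [uIoc_of_le ha]
    exact hfi.aestronglyMeasurable
  refine (intervalIntegral.hasDerivAt_integral_of_dominated_loc_of_deriv_le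
    (F' := fun x s => kernelS α (x - s) • f s) (bound := fun s => |kernelS α (m - a)| * ‖f s‖)
    (Ioi_mem_nhds hmt) (Eventually.of_forall fun x => ?_) ?_ ?_ ?_ ?_ ?_).2
  · exact ((measurable_fracKernel α).comp
      (measurable_const.sub measurable_id)).aestronglyMeasurable.smul hfm
  · refine ContinuousOn.intervalIntegrable_of_Icc ha (ContinuousOn.smul (fun s hs => ?_) hf)
    exact ((continuousAt_fracKernel α (sub_pos.2 (hs.2.trans_lt hat))).comp
      (continuousAt_const.sub continuousAt_id)).continuousWithinAt
  · exact ((measurable_kernelS α).comp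
      (measurable_const.sub measurable_id)).aestronglyMeasurable.smul hfm
  · refine Eventually.of_forall fun s hs x hx => ?_
    rw [uIoc_of_le ha] at hs
    rw [norm_smul, Real.norm_eq_abs]
    exact mul_le_mul_of_nonneg_right
      (abs_kernelS_le hα (by linarith) (by linarith [hs.2, mem_Ioi.1 hx])) (norm_nonneg _)
  · exact hfi.norm.const_mul _
  · refine Eventually.of_forall fun s hs x hx => ?_
    rw [uIoc_of_le ha] at hs
    have hxs : 0 < x - s := by linarith [hs.2, mem_Ioi.1 hx]
    have := (hasDerivAt_fracKernel hα.ne hxs).comp x ((hasDerivAt_id x).sub_const s)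
    simpa using this.smul_const (f s)

/-- Rescaling of a fractional integral to the unit interval. -/
theorem integral_fracKernel_sub_smul_eq_rescaled {α a x : ℝ} (hax : a < x) (f : ℝ → E) :
    ∫ s in a..x, fracKernel α (x - s) • f s =
      (x - a) ^ α • ∫ y in (0 : ℝ)..1, fracKernel α (1 - y) • f (a + (x - a) * y) := by
  have hc : 0 < x - a := sub_pos.2 hax
  have h := intervalIntegral.smul_integral_comp_add_mul (a := 0) (b := 1)
    (fun s => fracKernel α (x - s) • f s) (x - a) a
  have h1 : a + (x - a) * 1 = x := by ring
  rw [mul_zero, add_zero, h1] at h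
  rw [← h, ← intervalIntegral.integral_smul, ← intervalIntegral.integral_smul]
  refine intervalIntegral.integral_congr fun y hy => ?_
  rw [uIcc_of_le zero_le_one] at hy
  have h2 : x - (a + (x - a) * y) = (x - a) * (1 - y) := by ring
  have h3 : (x - a) ^ α = (x - a) * (x - a) ^ (α - 1) := by
    rw [Real.rpow_sub_one hc.ne']
    field_simp
  simp only [h2, smul_smul]
  congr 1
  rw [fracKernel, fracKernel, Real.mul_rpow hc.le (by linarith [hy.2]), h3]
  ring

/-- The derivative of a fractional integral with continuously differentiable density. -/
theorem hasDerivAt_integral_fracKernel_sub_right [CompleteSpace E] {α a t : ℝ} (hα : 0 < α)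
    (hat : a < t) {f f' : ℝ → E} (hf' : ∀ s, a ≤ s → HasDerivAt f (f' s) s)
    (hf'c : ContinuousOn f' (Ici a)) :
    HasDerivAt (fun x => ∫ s in a..x, fracKernel α (x - s) • f s)
      ((t - a)⁻¹ • ∫ s in a..t, fracKernel α (t - s) • (α • f s + (s - a) • f' s)) t := by
  have hc : 0 < t - a := sub_pos.2 hat
  have hfc : ContinuousOn f (Ici a) := fun s hs => (hf' s hs).continuousAt.continuousWithinAt
  have hmaps : ∀ x, a ≤ x → MapsTo (fun y => a + (x - a) * y) (Icc 0 1) (Ici a) := fun x hx y hy =>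
    mem_Ici.2 (by nlinarith [hy.1])
  have hK : IntervalIntegrable (fun y => fracKernel α (1 - y)) volume 0 1 :=
    intervalIntegrable_fracKernel_sub hα 1 0 1
  have hcomp : ∀ g : ℝ → E, ContinuousOn g (Ici a) → ∀ x, a ≤ x →
      ContinuousOn (fun y => g (a + (x - a) * y)) (uIcc 0 1) := fun g hg x hx => by
    rw [uIcc_of_le zero_le_one]
    exact hg.comp (by fun_prop) (hmaps x hx)
  have hint : ∀ g : ℝ → E, ContinuousOn g (Ici a) → ∀ x, a ≤ x → IntervalIntegrable
      (fun y => fracKernel α (1 - y) • g (a + (x - a) * y)) volume 0 1 := fun g hg x hx =>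
    hK.smul_continuousOn (hcomp g hg x hx)
  have hmeas : ∀ g : ℝ → E, IntervalIntegrable g volume 0 1 →
      AEStronglyMeasurable g (volume.restrict (uIoc 0 1)) := fun g hg => by
    rw [uIoc_of_le zero_le_one]
    exact hg.aestronglyMeasurable
  have hint' : IntervalIntegrable
      (fun y => fracKernel α (1 - y) • (y • f' (a + (t - a) * y))) volume 0 1 :=
    hK.smul_continuousOn (g := fun y => y • f' (a + (t - a) * y))
      (continuousOn_id.smul (hcomp f' hf'c t hat.le))
  obtain ⟨C, hC⟩ := isCompact_Icc.exists_bound_of_continuousOn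
    (hf'c.mono (Icc_subset_Ici_self : Icc a (t + 1) ⊆ Ici a))
  -- After rescaling, $x$ enters only through the argument of $f$; the kernel is a fixed integrable
  -- weight, so dominated differentiation applies.
  have hinner : HasDerivAt
      (fun x => ∫ y in (0 : ℝ)..1, fracKernel α (1 - y) • f (a + (x - a) * y))
      (∫ y in (0 : ℝ)..1, fracKernel α (1 - y) • (y • f' (a + (t - a) * y))) t := by
    have hnhds : Ioo a (t + 1) ∈ 𝓝 t := Ioo_mem_nhds hat (by linarith)
    refine (intervalIntegral.hasDerivAt_integral_of_dominated_loc_of_deriv_le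
      (F' := fun x y => fracKernel α (1 - y) • (y • f' (a + (x - a) * y)))
      (bound := fun y => ‖fracKernel α (1 - y)‖ * C)
      hnhds ?_ (hint f hfc t hat.le) ?_ ?_ (hK.norm.mul_const C) ?_).2
    · filter_upwards [hnhds] with x hx
      exact hmeas _ (hint f hfc x hx.1.le)
    · exact hmeas _ hint'
    · refine Eventually.of_forall fun y hy x hx => ?_
      rw [uIoc_of_le zero_le_one] at hy
      have h1 := hC (a + (x - a) * y) ⟨hmaps x hx.1.le ⟨hy.1.le, hy.2⟩, by
        nlinarith [hy.1, hy.2, hx.1, hx.2]⟩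
      rw [norm_smul, norm_smul, Real.norm_of_nonneg hy.1.le]
      gcongr
      calc y * ‖f' (a + (x - a) * y)‖ ≤ 1 * ‖f' (a + (x - a) * y)‖ := by
            gcongr
            exact hy.2
        _ ≤ C := by rwa [one_mul]
    · refine Eventually.of_forall fun y hy x hx => ?_
      rw [uIoc_of_le zero_le_one] at hy
      have h1 : HasDerivAt (fun x => a + (x - a) * y) y x := by
        simpa using (((hasDerivAt_id x).sub_const a).mul_const y).const_add a
      exact ((hf' _ (hmaps x hx.1.le ⟨hy.1.le, hy.2⟩)).scomp x h1).const_smul _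
  have houter : HasDerivAt (fun x : ℝ => (x - a) ^ α) (α * (t - a) ^ (α - 1)) t := by
    simpa using ((hasDerivAt_id t).sub_const a).rpow_const (p := α) (Or.inl hc.ne')
  refine ((houter.smul hinner).congr_of_eventuallyEq ?_).congr_deriv ?_
  · filter_upwards [Ioi_mem_nhds hat] with x hx
    exact integral_fracKernel_sub_smul_eq_rescaled hx f
  · have hsplit : ∫ y in (0 : ℝ)..1, fracKernel α (1 - y) •
          (α • f (a + (t - a) * y) + (a + (t - a) * y - a) • f' (a + (t - a) * y)) =
        α • (∫ y in (0 : ℝ)..1, fracKernel α (1 - y) • f (a + (t - a) * y)) +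
          (t - a) • ∫ y in (0 : ℝ)..1, fracKernel α (1 - y) • (y • f' (a + (t - a) * y)) := by
      have h1 : IntervalIntegrable
          (fun y => α • fracKernel α (1 - y) • f (a + (t - a) * y)) volume 0 1 :=
        (hint f hfc t hat.le).smul α
      have h2 : IntervalIntegrable
          (fun y => (t - a) • fracKernel α (1 - y) • (y • f' (a + (t - a) * y))) volume 0 1 :=
        hint'.smul (t - a)
      rw [← intervalIntegral.integral_smul, ← intervalIntegral.integral_smul,
        ← intervalIntegral.integral_add h1 h2]
      refine intervalIntegral.integral_congr fun y _ => ?_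
      simp only [add_sub_cancel_left, smul_add, smul_smul]
      congr 2 <;> ring
    rw [integral_fracKernel_sub_smul_eq_rescaled hat, hsplit]
    have h3 : (t - a) ^ (α - 1) = (t - a)⁻¹ * (t - a) ^ α := by
      rw [Real.rpow_sub_one hc.ne']
      field_simp
    simp only [smul_add, smul_smul]
    rw [add_comm, h3]
    congr 2
    · ring
    · field_simp

/-! ### Hadamard finite parts -/

/-- The difference of two expansions is $\varepsilon^{-p}(d-c)$ with a finite limit; multiplying by
$\varepsilon^p \to 0$ forces $d = c$. -/
theorem HasFinitePart.unique {p : ℝ} (hp : 0 < p) {f : ℝ → E} {t : ℝ} {I J : E}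
    (hI : HasFinitePart p f t I) (hJ : HasFinitePart p f t J) : I = J := by
  obtain ⟨-, c, hc⟩ := hI
  obtain ⟨-, d, hd⟩ := hJ
  have hsub : Tendsto (fun ε : ℝ => ε ^ (-p) • (d - c)) (𝓝[>] 0) (𝓝 (I - J)) := by
    refine (hc.sub hd).congr fun ε => ?_
    rw [smul_sub]
    abel
  have hpow : Tendsto (fun ε : ℝ => ε ^ p) (𝓝[>] 0) (𝓝 0) := by
    have := (Real.continuous_rpow_const hp.le).tendsto 0
    rw [Real.zero_rpow hp.ne'] at this
    exact this.mono_left nhdsWithin_le_nhds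
  have hdc : d - c = 0 := by
    have h1 := hpow.smul hsub
    rw [zero_smul] at h1
    refine tendsto_nhds_unique (tendsto_const_nhds.congr' ?_) h1
    filter_upwards [self_mem_nhdsWithin] with ε hε
    rw [smul_smul, ← Real.rpow_add hε, add_neg_cancel, Real.rpow_zero, one_smul]
  rw [hdc] at hsub
  simp only [smul_zero] at hsub
  exact sub_eq_zero.1 (tendsto_nhds_unique hsub tendsto_const_nhds)

theorem tendsto_fracKernel_mul_self {α : ℝ} (hα : 0 < α) :
    Tendsto (fun ε : ℝ => fracKernel α ε * ε) (𝓝[>] 0) (𝓝 0) := by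
  have h : Tendsto (fun ε : ℝ => ε ^ α / Real.Gamma α) (𝓝[>] 0) (𝓝 0) := by
    have := ((Real.continuous_rpow_const hα.le).tendsto 0).div_const (Real.Gamma α)
    rw [Real.zero_rpow hα.ne', zero_div] at this
    exact this.mono_left nhdsWithin_le_nhds
  refine h.congr' ?_
  filter_upwards [self_mem_nhdsWithin] with ε hε
  have hε' : ε ≠ 0 := ne_of_gt hε
  rw [fracKernel, Real.rpow_sub_one hε']
  field_simp

/-- The increment of $f$ is $O(\varepsilon)$ and beats $\varepsilon^{\alpha-1}$. Hence
$f(t-\varepsilon)$ can be replaced by $f(t)$ in a divergent boundary term. -/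
theorem tendsto_fracKernel_smul_sub {α t : ℝ} (hα : 0 < α) {f : ℝ → E} {d : E}
    (hf : HasDerivAt f d t) :
    Tendsto (fun ε : ℝ => fracKernel α ε • (f t - f (t - ε))) (𝓝[>] 0) (𝓝 0) := by
  have hneg : Tendsto (fun ε : ℝ => -ε) (𝓝[>] 0) (𝓝[<] 0) := by
    simpa using tendsto_neg_nhdsGT (a := (0 : ℝ))
  have h := (tendsto_fracKernel_mul_self hα).smul (hf.tendsto_slope_zero_left.comp hneg)
  rw [zero_smul] at h
  refine h.congr' ?_
  filter_upwards [self_mem_nhdsWithin] with ε hε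
  have hε' : ε ≠ 0 := ne_of_gt hε
  simp only [Function.comp, smul_smul, ← sub_eq_add_neg]
  rw [← neg_sub (f t), smul_neg, ← neg_smul]
  congr 1
  field_simp

/-- Integration by parts against the singular kernel, with a weight that vanishes at the left end
point. -/
theorem smul_integral_kernelS [CompleteSpace E] {α a b t : ℝ} (hα : α ≠ 1) (hab : a ≤ b)
    (hbt : b < t) {f f' : ℝ → E} (hf' : ∀ s ∈ Icc a b, HasDerivAt f (f' s) s)
    (hf'c : ContinuousOn f' (Icc a b)) :
    (t - a) • ∫ s in a..b, kernelS α (t - s) • f s =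
      (∫ s in a..b, fracKernel α (t - s) • (α • f s + (s - a) • f' s)) -
        (fracKernel α (t - b) * (b - a)) • f b := by
  have hfc : ContinuousOn f (Icc a b) := fun s hs => (hf' s hs).continuousAt.continuousWithinAt
  have hpos : ∀ s ∈ Icc a b, 0 < t - s := fun s hs => by linarith [hs.2]
  have hKc : ContinuousOn (fun s => fracKernel α (t - s)) (Icc a b) := fun s hs =>
    ((continuousAt_fracKernel α (hpos s hs)).comp
      (continuousAt_const.sub continuousAt_id)).continuousWithinAt
  have h1 : IntervalIntegrable (fun s => (t - a) • kernelS α (t - s) • f s) volume a b :=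
    ((continuousOn_kernelS_sub_smul hbt hfc).intervalIntegrable_of_Icc hab).smul (t - a)
  have h2 : IntervalIntegrable
      (fun s => fracKernel α (t - s) • (α • f s + (s - a) • f' s)) volume a b :=
    (hKc.smul ((hfc.const_smul α).add
      ((continuousOn_id.sub continuousOn_const).smul hf'c))).intervalIntegrable_of_Icc hab
  -- Writing $s-a = (t-a)-(t-s)$ and using $(t-s)K_S(t-s) = (\alpha-1)\,$`fracKernel α (t - s)`
  -- isolates $(t-a)K_S$; the remaining terms are weakly singular.
  have hderiv : ∀ s ∈ uIcc a b, HasDerivAt (fun s => (fracKernel α (t - s) * (s - a)) • f s)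
      (fracKernel α (t - s) • (α • f s + (s - a) • f' s) -
        (t - a) • kernelS α (t - s) • f s) s := fun s hs => by
    rw [uIcc_of_le hab] at hs
    have hK : HasDerivAt (fun s => fracKernel α (t - s)) (kernelS α (t - s) * -1) s :=
      (hasDerivAt_fracKernel hα (hpos s hs)).comp s ((hasDerivAt_id s).const_sub t)
    have hw : HasDerivAt (fun s => fracKernel α (t - s) * (s - a))
        (kernelS α (t - s) * -1 * (s - a) + fracKernel α (t - s) * 1) s :=
      hK.mul ((hasDerivAt_id s).sub_const a)
    refine (hw.smul (hf' s hs)).congr_deriv ?_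
    have hmul := mul_kernelS hα (hpos s hs)
    have hcoef : kernelS α (t - s) * -1 * (s - a) + fracKernel α (t - s) * 1 =
        fracKernel α (t - s) * α - (t - a) * kernelS α (t - s) := by
      linear_combination hmul
    rw [hcoef, sub_smul]
    simp only [smul_add, smul_smul]
    abel
  have hftc := intervalIntegral.integral_eq_sub_of_hasDerivAt hderiv (h2.sub h1)
  rw [intervalIntegral.integral_sub h2 h1, intervalIntegral.integral_smul] at hftc
  simp only [sub_self, mul_zero, zero_smul, sub_zero] at hftc
  rw [← hftc]
  abel

/-- The derivative of the fractional integral is the finite part of the integral against the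
differentiated kernel. -/
theorem exists_hasDerivAt_fracInt_and_hasFinitePart [CompleteSpace E] {α t : ℝ} (hα0 : 0 < α)
    (hα1 : α < 1) (ht : 0 < t) {f : ℝ → E} (hfc : ContinuousOn f (Ici 0))
    (hfd : ContDiffOn ℝ 1 f (Ioi 0)) :
    ∃ I : E, HasDerivAt (fracInt α f) I t ∧
      HasFinitePart (1 - α) (fun s => kernelS α (t - s) • f s) t I := by
  -- Split at an interior point: on $[0,a]$ the kernel is smooth but $f'$ may blow up at $0$; on
  -- $[a,t]$ the kernel is singular but $f$ is $C^1$.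
  obtain ⟨a, ha0, hat⟩ := exists_between ht
  have hc : 0 < t - a := sub_pos.2 hat
  have hd : ∀ s, 0 < s → HasDerivAt f (deriv f s) s := fun s hs =>
    ((hfd.differentiableOn one_ne_zero).differentiableAt (Ioi_mem_nhds hs)).hasDerivAt
  have hd' : ∀ s, a ≤ s → HasDerivAt f (deriv f s) s := fun s hs => hd s (ha0.trans_le hs)
  have hdc : ContinuousOn (deriv f) (Ici a) :=
    (hfd.continuousOn_deriv_of_isOpen isOpen_Ioi le_rfl).mono (Ici_subset_Ioi.2 ha0)
  have hKf : ∀ x y, 0 ≤ y → IntervalIntegrable (fun s => fracKernel α (x - s) • f s) volume 0 y :=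
    fun x y hy => (intervalIntegrable_fracKernel_sub hα0 x 0 y).smul_continuousOn
      (hfc.mono (by rw [uIcc_of_le hy]; exact Icc_subset_Ici_self))
  have hS : ∀ b, b < t → ContinuousOn (fun s => kernelS α (t - s) • f s) (Icc 0 b) := fun b hb =>
    continuousOn_kernelS_sub_smul hb (hfc.mono Icc_subset_Ici_self)
  have hSint : ∀ ε ∈ Ioo 0 t,
      IntervalIntegrable (fun s => kernelS α (t - s) • f s) volume 0 (t - ε) := fun ε hε =>
    (hS _ (by linarith [hε.1])).intervalIntegrable_of_Icc (by linarith [hε.2])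
  set Φ : ℝ → E := fun s => fracKernel α (t - s) • (α • f s + (s - a) • deriv f s) with hΦ
  have hΦint : IntervalIntegrable Φ volume a t := by
    refine (intervalIntegrable_fracKernel_sub hα0 t a t).smul_continuousOn ?_
    rw [uIcc_of_le hat.le]
    exact ((hfc.mono (Icc_subset_Ici_self.trans (Ici_subset_Ici.2 ha0.le))).const_smul α).add
      ((continuousOn_id.sub continuousOn_const).smul (hdc.mono Icc_subset_Ici_self))
  -- The divergent coefficient $-f(t)/\Gamma(\alpha)$ comes from the boundary term at
  -- $t-\varepsilon$ of the integration by parts.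
  refine ⟨(∫ s in (0 : ℝ)..a, kernelS α (t - s) • f s) + (t - a)⁻¹ • ∫ s in a..t, Φ s,
    ?_, hSint, -(Real.Gamma α)⁻¹ • f t, ?_⟩
  · have h1 := hasDerivAt_integral_fracKernel_sub hα1 ha0.le hat (f := f)
      (hfc.mono Icc_subset_Ici_self)
    have h2 := hasDerivAt_integral_fracKernel_sub_right hα0 hat hd' hdc
    refine (h1.add h2).congr_of_eventuallyEq ?_
    filter_upwards [Ioi_mem_nhds hat] with x hx
    have hx0 : 0 < x := ha0.trans hx
    refine (intervalIntegral.integral_add_adjacent_intervals (hKf x a ha0.le) ?_).symm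
    refine (hKf x x hx0.le).mono_set ?_
    rw [uIcc_of_le hx0.le, uIcc_of_le (le_of_lt hx)]
    exact Icc_subset_Icc_left ha0.le
  · have hlim_sub : Tendsto (fun ε : ℝ => t - ε) (𝓝[>] 0) (𝓝 t) := by
      have : Tendsto (fun ε : ℝ => t - ε) (𝓝 0) (𝓝 (t - 0)) := tendsto_const_nhds.sub tendsto_id
      rw [sub_zero] at this
      exact this.mono_left nhdsWithin_le_nhds
    have hnear : Ioo 0 (t - a) ∈ 𝓝[>] (0 : ℝ) := Ioo_mem_nhdsGT hc
    have hΦlim : Tendsto (fun ε : ℝ => ∫ s in a..(t - ε), Φ s) (𝓝[>] 0) (𝓝 (∫ s in a..t, Φ s)) := by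
      have hcont := intervalIntegral.continuousOn_primitive_interval' hΦint left_mem_uIcc
      refine (hcont t right_mem_uIcc).tendsto.comp (tendsto_nhdsWithin_iff.2 ⟨hlim_sub, ?_⟩)
      filter_upwards [hnear] with ε hε
      rw [uIcc_of_le hat.le]
      exact ⟨by linarith [hε.2], by linarith [hε.1]⟩
    have hrem := (tendsto_fracKernel_smul_sub hα0 (hd t ht)).add
      (((tendsto_fracKernel_mul_self hα0).const_mul (t - a)⁻¹).smul
        ((hd t ht).continuousAt.tendsto.comp hlim_sub))
    have hall := ((tendsto_const_nhds (x := ∫ s in (0 : ℝ)..a, kernelS α (t - s) • f s)).add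
      (hΦlim.const_smul (t - a)⁻¹)).add hrem
    rw [mul_zero, zero_smul, add_zero, add_zero] at hall
    refine hall.congr' ?_
    filter_upwards [hnear] with ε hε
    have hε0 : ε ≠ 0 := hε.1.ne'
    have haε : a ≤ t - ε := by linarith [hε.2]
    have hεt : t - ε < t := by linarith [hε.1]
    have hparts := smul_integral_kernelS hα1.ne haε hεt (fun s hs => hd' s hs.1)
      (hdc.mono Icc_subset_Ici_self)
    have hsplit := intervalIntegral.integral_add_adjacent_intervals (μ := volume)
      ((hS a hat).intervalIntegrable_of_Icc ha0.le)
      (((hS _ hεt).mono (Icc_subset_Icc_left ha0.le)).intervalIntegrable_of_Icc haε)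
    have hsolve : ∫ s in a..(t - ε), kernelS α (t - s) • f s =
        (t - a)⁻¹ • ((∫ s in a..(t - ε), Φ s) -
          (fracKernel α (t - (t - ε)) * (t - ε - a)) • f (t - ε)) := by
      rw [← hparts, smul_smul, inv_mul_cancel₀ hc.ne', one_smul]
    have hker : ε ^ (-(1 - α)) • -(Real.Gamma α)⁻¹ • f t = -(fracKernel α ε • f t) := by
      rw [fracKernel, neg_sub, neg_smul, smul_neg, smul_smul, div_eq_mul_inv]
    have hcoef : (t - a)⁻¹ * (fracKernel α ε * (t - ε - a)) =
        fracKernel α ε - (t - a)⁻¹ * (fracKernel α ε * ε) := by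
      field_simp
      ring
    rw [← hsplit, hsolve, hker, sub_sub_cancel, smul_sub, smul_sub, smul_smul, hcoef,
      sub_smul]
    simp only [Function.comp]
    abel

/-! ### Reduction of both equations to the integrated equation -/

theorem intervalIntegrable_fracKernel_smul {α t : ℝ} (hα : 0 < α) (ht : 0 < t) {f : ℝ → E}
    (hf : ContinuousOn f (Ici 0)) :
    IntervalIntegrable (fun s => fracKernel α (t - s) • f s) volume 0 t :=
  (intervalIntegrable_fracKernel_sub hα t 0 t).smul_continuousOn
    (hf.mono (by rw [uIcc_of_le ht.le]; exact Icc_subset_Ici_self))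

/-- A continuous solution of the Volterra equation with singular kernel solves the integrated,
weakly singular equation. -/
theorem eq_sub_fracInt_of_volterra [CompleteSpace E]
    {α : ℝ} (hα0 : 0 < α) (hα1 : α < 1) (A : E →L[ℝ] E)
    {u : ℝ → E} (huc : ContinuousOn u (Ici 0)) (hud : ContDiffOn ℝ 1 u (Ioi 0))
    (h : ∀ t : ℝ, 0 < t → ∃ I : E,
      HasFinitePart (1 - α) (fun s => kernelS α (t - s) • A (u s)) t I ∧ deriv u t + I = 0)
    {t : ℝ} (ht : 0 < t) : u t = u 0 - fracInt α (fun s => A (u s)) t := by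
  have hAc : ContinuousOn (fun s => A (u s)) (Ici 0) := A.continuous.comp_continuousOn huc
  have hAd : ContDiffOn ℝ 1 (fun s => A (u s)) (Ioi 0) := A.contDiff.comp_contDiffOn hud
  -- By uniqueness of finite parts, the $I$ in the equation is the derivative of the fractional
  -- integral, and the sum has derivative zero.
  have hderiv : ∀ s ∈ Ioi (0 : ℝ), HasDerivAt (u + fracInt α fun s => A (u s)) 0 s := by
    intro s hs
    obtain ⟨I, hI, hIu⟩ := h s hs
    obtain ⟨J, hJd, hJ⟩ := exists_hasDerivAt_fracInt_and_hasFinitePart hα0 hα1 hs hAc hAd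
    rw [hJ.unique (by linarith) hI] at hJd
    rw [← hIu]
    exact (((hud.differentiableOn one_ne_zero).differentiableAt
      (Ioi_mem_nhds hs)).hasDerivAt).add hJd
  have hconst : ∀ s ∈ Ioi (0 : ℝ),
      (u + fracInt α fun s => A (u s)) s = (u + fracInt α fun s => A (u s)) t := fun s hs =>
    isOpen_Ioi.is_const_of_deriv_eq_zero isPreconnected_Ioi
      (fun x hx => (hderiv x hx).differentiableAt.differentiableWithinAt)
      (fun x hx => (hderiv x hx).deriv) hs ht
  have hu0 : Tendsto u (𝓝[>] 0) (𝓝 (u 0)) :=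
    (huc 0 self_mem_Ici).tendsto.mono_left (nhdsWithin_mono _ Ioi_subset_Ici_self)
  -- A bounded density gives $O(t^\alpha)$. The constant must be found as a limit, since $u$ need
  -- not be differentiable at $0$.
  have hJ0 : Tendsto (fracInt α fun s => A (u s)) (𝓝[>] 0) (𝓝 0) := by
    obtain ⟨W, hW⟩ := isCompact_Icc.exists_bound_of_continuousOn
      (hAc.mono (Icc_subset_Ici_self : Icc (0 : ℝ) 1 ⊆ Ici 0))
    have hK : Tendsto (fun s => W * fracKernel (1 + α) s) (𝓝[>] 0) (𝓝 0) := by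
      have := (((Real.continuous_rpow_const hα0.le).tendsto 0).div_const
        (Real.Gamma (1 + α))).const_mul W
      rw [Real.zero_rpow hα0.ne', zero_div, mul_zero] at this
      simp only [fracKernel, add_sub_cancel_left]
      exact this.mono_left nhdsWithin_le_nhds
    refine squeeze_zero_norm' ?_ hK
    filter_upwards [Ioo_mem_nhdsGT one_pos] with s hs
    refine norm_fracInt_le hα0 one_pos hs.1 fun r hr => ?_
    rw [fracKernel_one, mul_one]
    exact hW r ⟨hr.1.le, hr.2.trans hs.2.le⟩
  have hlim : Tendsto (u + fracInt α fun s => A (u s)) (𝓝[>] 0) (𝓝 (u 0 + 0)) := hu0.add hJ0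
  have heq : u 0 + 0 = (u + fracInt α fun s => A (u s)) t :=
    tendsto_nhds_unique hlim (tendsto_const_nhds.congr' (by
      filter_upwards [self_mem_nhdsWithin] with s hs
      exact (hconst s hs).symm))
  rw [eq_sub_iff_add_eq, ← add_zero (u 0), heq]
  rfl

/-- Differentiate: the derivative of the fractional integral is the finite part, and the constant
drops out. -/
theorem volterra_of_eq_sub_fracInt [CompleteSpace E]
    {α : ℝ} (hα0 : 0 < α) (hα1 : α < 1) (A : E →L[ℝ] E)
    {u : ℝ → E} (huc : ContinuousOn u (Ici 0)) (hud : ContDiffOn ℝ 1 u (Ioi 0)) {c : E}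
    (h : ∀ t : ℝ, 0 < t → u t = c - fracInt α (fun s => A (u s)) t) {t : ℝ} (ht : 0 < t) :
    ∃ I : E, HasFinitePart (1 - α) (fun s => kernelS α (t - s) • A (u s)) t I ∧
      deriv u t + I = 0 := by
  obtain ⟨I, hId, hI⟩ := exists_hasDerivAt_fracInt_and_hasFinitePart hα0 hα1 ht
    (A.continuous.comp_continuousOn huc) (A.contDiff.comp_contDiffOn hud)
  refine ⟨I, hI, ?_⟩
  have hu : HasDerivAt u (-I) t := by
    refine (hId.const_sub c).congr_of_eventuallyEq ?_
    filter_upwards [Ioi_mem_nhds ht] with s hs using h s hs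
  rw [hu.deriv, neg_add_cancel]

theorem caputo_integrand_eq {α : ℝ} (hα1 : α < 1) (u : ℝ → E) (t τ : ℝ) :
    (t - τ) ^ (-α) • deriv u τ =
      Real.Gamma (1 - α) • fracKernel (1 - α) (t - τ) • deriv u τ := by
  have hG := (Real.Gamma_pos_of_pos (sub_pos.2 hα1)).ne'
  rw [fracKernel, smul_smul, mul_div_cancel₀ _ hG]
  ring_nf

theorem caputoDeriv_eq_fracInt {α : ℝ} (hα1 : α < 1) (u : ℝ → E) (t : ℝ) :
    caputoDeriv α u t = fracInt (1 - α) (deriv u) t := by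
  have hG := (Real.Gamma_pos_of_pos (sub_pos.2 hα1)).ne'
  simp only [caputoDeriv, fracInt, caputo_integrand_eq hα1]
  rw [intervalIntegral.integral_smul, smul_smul, one_div_mul_cancel hG, one_smul]

/-- Abel's inversion: a solution of the Caputo equation solves the integrated equation. -/
theorem eq_sub_fracInt_of_caputo [CompleteSpace E]
    {α : ℝ} (hα0 : 0 < α) (hα1 : α < 1) (A : E →L[ℝ] E)
    {u : ℝ → E} (huc : ContinuousOn u (Ici 0)) (hud : ContDiffOn ℝ 1 u (Ioi 0))
    (h : ∀ t : ℝ, 0 < t →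
      IntervalIntegrable (fun τ => (t - τ) ^ (-α) • deriv u τ) volume 0 t ∧
        caputoDeriv α u t = -A (u t))
    {t : ℝ} (ht : 0 < t) : u t = u 0 - fracInt α (fun s => A (u s)) t := by
  -- Regularity does not control $u'$ near $0$. Multiplying the convergent Caputo integrand by the
  -- bounded factor $(t-\tau)^\alpha$ does.
  have hint : IntervalIntegrable (deriv u) volume 0 t := by
    have h1 := (h t ht).1.continuousOn_smul (f := fun τ => (t - τ) ^ α)
      ((continuous_const.sub continuous_id).rpow_const fun _ => Or.inr hα0.le).continuousOn
    rw [intervalIntegrable_iff_integrableOn_Ioo_of_le ht.le] at h1 ⊢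
    refine h1.congr_fun (fun τ hτ => ?_) measurableSet_Ioo
    simp only [smul_smul]
    rw [← Real.rpow_add (sub_pos.2 hτ.2), add_neg_cancel, Real.rpow_zero, one_smul]
  have hftc : ∫ τ in (0 : ℝ)..t, deriv u τ = u t - u 0 :=
    intervalIntegral.integral_eq_sub_of_hasDerivAt_of_le ht.le
      (huc.mono Icc_subset_Ici_self)
      (fun s hs => ((hud.differentiableOn one_ne_zero).differentiableAt
        (Ioi_mem_nhds hs.1)).hasDerivAt) hint
  have hintO := (intervalIntegrable_iff_integrableOn_Ioo_of_le ht.le).1 hint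
  have hsg := fracInt_fracInt hα0 (sub_pos.2 hα1) ht hintO.aestronglyMeasurable
    (by simpa using hintO)
  have h2 : fracInt (1 - α + α) (deriv u) t = u t - u 0 := by
    rw [← hftc, sub_add_cancel, fracInt]
    simp only [fracKernel_one, one_smul]
  have h3 : fracInt α (fracInt (1 - α) (deriv u)) t = -fracInt α (fun s => A (u s)) t := by
    rw [fracInt, fracInt, ← intervalIntegral.integral_neg]
    refine intervalIntegral.integral_congr_ae (Eventually.of_forall fun s hs => ?_)
    rw [uIoc_of_le ht.le] at hs
    rw [← caputoDeriv_eq_fracInt hα1, (h s hs.1).2, smul_neg]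
  rw [h2, h3] at hsg
  rw [sub_eq_add_neg, hsg]
  abel

/-! ### The Mittag-Leffler flow of a bounded operator -/

/-- The orbit of a vector under the powers of `-A`. -/
def negOrbit (A : E →L[ℝ] E) (u₀ : E) (k : ℕ) : E :=
  ((-A) ^ k) u₀

theorem negOrbit_succ (A : E →L[ℝ] E) (u₀ : E) (k : ℕ) :
    negOrbit A u₀ (k + 1) = -A (negOrbit A u₀ k) := by
  simp [negOrbit, pow_succ']

theorem norm_negOrbit_le (A : E →L[ℝ] E) (u₀ : E) (k : ℕ) :
    ‖negOrbit A u₀ k‖ ≤ ‖u₀‖ * ‖A‖ ^ k := by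
  induction k with
  | zero => simp [negOrbit]
  | succ k ih =>
    rw [negOrbit_succ, norm_neg, pow_succ', mul_left_comm]
    exact (A.le_opNorm _).trans (by gcongr)

theorem norm_negOrbit_succ_le (A : E →L[ℝ] E) (u₀ : E) (k : ℕ) :
    ‖negOrbit A u₀ (k + 1)‖ ≤ ‖u₀‖ * ‖A‖ * ‖A‖ ^ k := by
  rw [mul_assoc, ← pow_succ']
  exact norm_negOrbit_le A u₀ (k + 1)

/-- The Mittag-Leffler flow `t ↦ E_α(-t^α A) u₀` of a bounded operator. -/
noncomputable def operatorFlow (α : ℝ) (A : E →L[ℝ] E) (u₀ : E) : ℝ → E :=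
  reducedSeries α 1 (negOrbit A u₀)

theorem operatorFlow_zero {α : ℝ} (hα : 0 < α) (A : E →L[ℝ] E) (u₀ : E) :
    operatorFlow α A u₀ 0 = u₀ := by
  rw [operatorFlow, reducedSeries, tsum_eq_single 0]
  · simp [negOrbit]
  · intro k hk
    simp [Real.zero_rpow hα.ne', hk]

theorem operatorFlow_eq_fracSeries {α t : ℝ} (ht : 0 < t) (A : E →L[ℝ] E) (u₀ : E) :
    operatorFlow α A u₀ t = fracSeries α 1 (negOrbit A u₀) t := by
  rw [fracSeries_eq_rpow_smul ht, sub_self, Real.rpow_zero, one_smul, operatorFlow]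

theorem continuousOn_operatorFlow [CompleteSpace E] {α : ℝ} (hα : 0 < α) (A : E →L[ℝ] E) (u₀ : E) :
    ContinuousOn (operatorFlow α A u₀) (Ici 0) :=
  continuousOn_reducedSeries hα one_pos (norm_nonneg A) (norm_negOrbit_le A u₀)

theorem map_operatorFlow [CompleteSpace E]
    {α t : ℝ} (hα : 0 < α) (ht : 0 < t) (A : E →L[ℝ] E) (u₀ : E) :
    A (operatorFlow α A u₀ t) = -fracSeries α 1 (fun k => negOrbit A u₀ (k + 1)) t := by
  rw [operatorFlow_eq_fracSeries ht, fracSeries, fracSeries, ContinuousLinearMap.map_tsum _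
    (summable_norm_fracSeries hα one_pos (norm_nonneg A) (norm_negOrbit_le A u₀) ht).of_norm,
    ← tsum_neg]
  refine tsum_congr fun k => ?_
  rw [map_smul, negOrbit_succ, smul_neg, neg_neg]

/-- Splitting off $k=0$ shifts the orbit by one and raises $\gamma$ from $1$ to $1+\alpha$, so the
rest is a fractional integral of a series of lower order. -/
theorem operatorFlow_eq_add_fracSeries [CompleteSpace E]
    {α t : ℝ} (hα : 0 < α) (ht : 0 < t) (A : E →L[ℝ] E)
    (u₀ : E) :
    operatorFlow α A u₀ t =
      u₀ + fracSeries α (1 + α) (fun k => negOrbit A u₀ (k + 1)) t := by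
  rw [operatorFlow_eq_fracSeries ht, fracSeries, fracSeries, Summable.tsum_eq_zero_add
    (summable_norm_fracSeries hα one_pos (norm_nonneg A) (norm_negOrbit_le A u₀) ht).of_norm]
  congr 1
  · simp [negOrbit]
  · refine tsum_congr fun k => ?_
    push_cast
    ring_nf

theorem operatorFlow_eq_sub_fracInt [CompleteSpace E]
    {α t : ℝ} (hα : 0 < α) (ht : 0 < t) (A : E →L[ℝ] E)
    (u₀ : E) :
    operatorFlow α A u₀ t = u₀ - fracInt α (fun s => A (operatorFlow α A u₀ s)) t := by
  rw [operatorFlow_eq_add_fracSeries hα ht, ← fracInt_fracSeries hα hα one_pos (norm_nonneg A)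
    (norm_negOrbit_succ_le A u₀) ht, sub_eq_add_neg, fracInt, fracInt,
    ← intervalIntegral.integral_neg]
  congr 1
  refine intervalIntegral.integral_congr_ae (Eventually.of_forall fun s hs => ?_)
  rw [uIoc_of_le ht.le] at hs
  rw [map_operatorFlow hα hs.1, smul_neg, neg_neg]

/-- No termwise differentiation: the series of order $1+\alpha$ is $J^1$ of the one of order
$\alpha$, whose singularity $t^{\alpha-1}$ is integrable, so the fundamental theorem of calculus
applies. -/
theorem hasDerivAt_operatorFlow [CompleteSpace E]
    {α t : ℝ} (hα : 0 < α) (ht : 0 < t) (A : E →L[ℝ] E) (u₀ : E) :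
    HasDerivAt (operatorFlow α A u₀)
      (fracSeries α α (fun k => negOrbit A u₀ (k + 1)) t) t := by
  set g : ℝ → E := fracSeries α α fun k => negOrbit A u₀ (k + 1) with hg
  have hgc : ContinuousOn g (Ioi 0) :=
    continuousOn_fracSeries hα hα (norm_nonneg A) (norm_negOrbit_succ_le A u₀)
  have hgi : IntervalIntegrable g volume 0 t := by
    simpa using intervalIntegrable_fracKernel_smul_fracSeries hα one_pos hα (norm_nonneg A)
      (norm_negOrbit_succ_le A u₀) ht
  have hint : ∀ s, 0 < s → operatorFlow α A u₀ s = u₀ + ∫ τ in (0 : ℝ)..s, g τ := fun s hs => by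
    rw [operatorFlow_eq_add_fracSeries hα hs, add_comm 1 α, ← fracInt_fracSeries hα one_pos hα
      (norm_nonneg A) (norm_negOrbit_succ_le A u₀) hs, fracInt]
    simp only [fracKernel_one, one_smul, hg]
  have hprim : HasDerivAt (fun s => u₀ + ∫ τ in (0 : ℝ)..s, g τ) (g t) t :=
    (intervalIntegral.integral_hasDerivAt_right hgi
      (hgc.stronglyMeasurableAtFilter isOpen_Ioi t ht)
      (hgc.continuousAt (Ioi_mem_nhds ht))).const_add u₀
  refine hprim.congr_of_eventuallyEq ?_
  filter_upwards [Ioi_mem_nhds ht] with s hs using hint s hs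

theorem contDiffOn_operatorFlow [CompleteSpace E] {α : ℝ} (hα : 0 < α) (A : E →L[ℝ] E) (u₀ : E) :
    ContDiffOn ℝ 1 (operatorFlow α A u₀) (Ioi 0) := by
  rw [show (1 : WithTop ℕ∞) = 0 + 1 by simp, contDiffOn_succ_iff_deriv_of_isOpen isOpen_Ioi]
  refine ⟨fun t ht => (hasDerivAt_operatorFlow hα ht A u₀).differentiableAt.differentiableWithinAt,
    by simp, ?_⟩
  rw [contDiffOn_zero]
  exact (continuousOn_fracSeries hα hα (norm_nonneg A) (norm_negOrbit_succ_le A u₀)).congr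
    fun t ht => (hasDerivAt_operatorFlow hα ht A u₀).deriv

/-- $J^{1-\alpha}$ raises the order of the derivative series from $\alpha$ to $1$, and the series of
order $1$ over the shifted orbit is $-A$ applied to the flow. -/
theorem caputo_operatorFlow [CompleteSpace E]
    {α : ℝ} (hα0 : 0 < α) (hα1 : α < 1) (A : E →L[ℝ] E) (u₀ : E)
    {t : ℝ} (ht : 0 < t) :
    IntervalIntegrable (fun τ => (t - τ) ^ (-α) • deriv (operatorFlow α A u₀) τ) volume 0 t ∧
      caputoDeriv α (operatorFlow α A u₀) t = -A (operatorFlow α A u₀ t) := by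
  have hβ : 0 < 1 - α := sub_pos.2 hα1
  have hderiv : ∀ τ, 0 < τ → deriv (operatorFlow α A u₀) τ =
      fracSeries α α (fun k => negOrbit A u₀ (k + 1)) τ := fun τ hτ =>
    (hasDerivAt_operatorFlow hα0 hτ A u₀).deriv
  have hint := intervalIntegrable_fracKernel_smul_fracSeries hα0 hβ hα0 (norm_nonneg A)
      (norm_negOrbit_succ_le A u₀) ht
  constructor
  · simp only [caputo_integrand_eq hα1]
    rw [intervalIntegrable_iff_integrableOn_Ioo_of_le ht.le] at hint ⊢
    refine IntegrableOn.congr_fun (hint.smul (Real.Gamma (1 - α))) (fun τ hτ => ?_)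
      measurableSet_Ioo
    simp only [Pi.smul_apply, hderiv τ hτ.1]
  · rw [caputoDeriv_eq_fracInt hα1, map_operatorFlow hα0 ht, neg_neg]
    have h1 := fracInt_fracSeries hα0 hβ hα0 (norm_nonneg A) (norm_negOrbit_succ_le A u₀) ht
    rw [add_sub_cancel] at h1
    rw [← h1, fracInt, fracInt]
    refine intervalIntegral.integral_congr_ae (Eventually.of_forall fun s hs => ?_)
    rw [uIoc_of_le ht.le] at hs
    rw [hderiv s hs.1]

theorem eq_operatorFlow_of_eq_sub_fracInt [CompleteSpace E]
    {α : ℝ} (hα : 0 < α) (A : E →L[ℝ] E) {u : ℝ → E}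
    (huc : ContinuousOn u (Ici 0))
    (h : ∀ t : ℝ, 0 < t → u t = u 0 - fracInt α (fun s => A (u s)) t) {t : ℝ} (ht : 0 ≤ t) :
    u t = operatorFlow α A (u 0) t := by
  obtain rfl | ht := ht.eq_or_lt
  · exact (operatorFlow_zero hα A (u 0)).symm
  have hUc := continuousOn_operatorFlow hα A (u 0)
  refine sub_eq_zero.1 (eq_zero_of_eq_fracInt hα (-A)
    (w := fun s => u s - operatorFlow α A (u 0) s) (huc.sub hUc) (fun s hs => ?_) ht)
  have h1 := intervalIntegrable_fracKernel_smul hα hs (f := fun r => A (u r))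
    (A.continuous.comp_continuousOn huc)
  have h2 := intervalIntegrable_fracKernel_smul hα hs (f := fun r => A (operatorFlow α A (u 0) r))
    (A.continuous.comp_continuousOn hUc)
  rw [h s hs, operatorFlow_eq_sub_fracInt hα hs, sub_sub_sub_cancel_left, fracInt, fracInt,
    fracInt, ← intervalIntegral.integral_sub h2 h1]
  refine intervalIntegral.integral_congr fun r _ => ?_
  simp only [neg_apply, map_sub, smul_sub, smul_neg]
  abel

end

/-! ### Transfer to matrices -/

theorem mulVec_neg_pow_eq_negOrbit {n : ℕ} (L : Matrix (Fin n) (Fin n) ℝ) (x : Fin n → ℝ)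
    (k : ℕ) :
    ((-L) ^ k).mulVec x = negOrbit L.mulVecLin.toContinuousLinearMap x k := by
  induction k with
  | zero => simp [negOrbit]
  | succ k ih =>
    rw [negOrbit_succ, ← ih, pow_succ', ← Matrix.mulVec_mulVec, Matrix.neg_mulVec]
    rfl

theorem mittagLefflerTerm_neg_smul {n : ℕ} (α r : ℝ) (L : Matrix (Fin n) (Fin n) ℝ) (k : ℕ) :
    mittagLefflerTerm α (-(r • L)) k = (r ^ k / Real.Gamma (α * k + 1)) • (-L) ^ k := by
  rw [mittagLefflerTerm, ← smul_neg, smul_pow, smul_smul]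
  congr 1
  ring

/-- Checked entrywise: the columns of $(-L)^k$ are orbits of the standard basis vectors, which grow
at most geometrically. -/
theorem summable_mittagLefflerTerm {n : ℕ} {α : ℝ} (hα : 0 < α) (r : ℝ)
    (L : Matrix (Fin n) (Fin n) ℝ) : Summable (mittagLefflerTerm α (-(r • L))) := by
  set A := L.mulVecLin.toContinuousLinearMap
  refine Pi.summable.2 fun i => Pi.summable.2 fun j => ?_
  set C := ‖(Pi.single j 1 : Fin n → ℝ)‖
  refine Summable.of_norm_bounded
    ((summable_pow_div_Gamma (γ := 1) hα (by positivity : 0 ≤ ‖A‖ * |r|)).mul_left C) fun k => ?_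
  have hentry : ((-L) ^ k) i j = negOrbit A (Pi.single j 1) k i := by
    rw [← mulVec_neg_pow_eq_negOrbit, Matrix.mulVec_single_one]
    rfl
  have hle : ‖((-L) ^ k) i j‖ ≤ C * ‖A‖ ^ k := by
    rw [hentry]
    exact (norm_le_pi_norm _ i).trans (norm_negOrbit_le A _ k)
  have hG : 0 < Real.Gamma (α * k + 1) := Real.Gamma_pos_of_pos (by positivity)
  rw [mittagLefflerTerm_neg_smul, Matrix.smul_apply, norm_smul, norm_div, norm_pow,
    Real.norm_of_nonneg hG.le, Real.norm_eq_abs r]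
  calc |r| ^ k / Real.Gamma (α * k + 1) * ‖((-L) ^ k) i j‖
      ≤ |r| ^ k / Real.Gamma (α * k + 1) * (C * ‖A‖ ^ k) := by gcongr
    _ = C * ((‖A‖ * |r|) ^ k / Real.Gamma (α * k + 1)) := by
        rw [mul_pow]
        ring

theorem mittagLefflerFlow_eq_operatorFlow {n : ℕ} {α : ℝ} (hα : 0 < α)
    (L : Matrix (Fin n) (Fin n) ℝ) (u₀ : Fin n → ℝ) :
    mittagLefflerFlow α L u₀ = operatorFlow α L.mulVecLin.toContinuousLinearMap u₀ := by
  funext t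
  let φ : Matrix (Fin n) (Fin n) ℝ →+ (Fin n → ℝ) :=
    AddMonoidHom.mk' (fun M => M.mulVec u₀) fun M N => Matrix.add_mulVec M N u₀
  have hφ : Continuous φ := continuous_id.matrix_mulVec continuous_const
  have h := ((summable_mittagLefflerTerm hα (t ^ α) L).hasSum.map φ hφ).tsum_eq
  change _ = mittagLefflerFlow α L u₀ t at h
  rw [← h, operatorFlow, reducedSeries]
  refine tsum_congr fun k => ?_
  change (mittagLefflerTerm α (-(t ^ α • L)) k).mulVec u₀ = _
  rw [mittagLefflerTerm_neg_smul, Matrix.smul_mulVec, mulVec_neg_pow_eq_negOrbit]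

theorem isRegular_mittagLefflerFlow {n : ℕ} {α : ℝ} (hα : 0 < α)
    (L : Matrix (Fin n) (Fin n) ℝ) (u₀ : Fin n → ℝ) :
    IsRegular (mittagLefflerFlow α L u₀) := by
  rw [mittagLefflerFlow_eq_operatorFlow hα]
  exact ⟨continuousOn_operatorFlow hα _ u₀, contDiffOn_operatorFlow hα _ u₀⟩

theorem mittagLefflerFlow_zero {n : ℕ} {α : ℝ} (hα : 0 < α)
    (L : Matrix (Fin n) (Fin n) ℝ) (u₀ : Fin n → ℝ) : mittagLefflerFlow α L u₀ 0 = u₀ := by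
  rw [mittagLefflerFlow_eq_operatorFlow hα, operatorFlow_zero hα]

theorem eq_mittagLefflerFlow_of_eq_sub_fracInt {n : ℕ} {α : ℝ} (hα : 0 < α)
    {L : Matrix (Fin n) (Fin n) ℝ} {u : ℝ → Fin n → ℝ} (hu : IsRegular u)
    (h : ∀ t : ℝ, 0 < t → u t = u 0 - fracInt α (fun s => L.mulVec (u s)) t) {t : ℝ}
    (ht : 0 ≤ t) : u t = mittagLefflerFlow α L (u 0) t := by
  rw [mittagLefflerFlow_eq_operatorFlow hα]
  exact eq_operatorFlow_of_eq_sub_fracInt hα L.mulVecLin.toContinuousLinearMap hu.1 h ht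

theorem SolvesVolterra.eq_sub_fracInt {n : ℕ} {α : ℝ} (hα0 : 0 < α) (hα1 : α < 1)
    {L : Matrix (Fin n) (Fin n) ℝ} {u : ℝ → Fin n → ℝ} (hu : IsRegular u)
    (h : SolvesVolterra α L u) {t : ℝ} (ht : 0 < t) :
    u t = u 0 - fracInt α (fun s => L.mulVec (u s)) t :=
  eq_sub_fracInt_of_volterra hα0 hα1 L.mulVecLin.toContinuousLinearMap hu.1 hu.2 h ht

theorem SolvesCaputo.eq_sub_fracInt {n : ℕ} {α : ℝ} (hα0 : 0 < α) (hα1 : α < 1)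
    {L : Matrix (Fin n) (Fin n) ℝ} {u : ℝ → Fin n → ℝ} (hu : IsRegular u)
    (h : SolvesCaputo α L u) {t : ℝ} (ht : 0 < t) :
    u t = u 0 - fracInt α (fun s => L.mulVec (u s)) t :=
  eq_sub_fracInt_of_caputo hα0 hα1 L.mulVecLin.toContinuousLinearMap hu.1 hu.2 h ht

theorem solvesVolterra_of_eq_sub_fracInt {n : ℕ} {α : ℝ} (hα0 : 0 < α) (hα1 : α < 1)
    {L : Matrix (Fin n) (Fin n) ℝ} {u : ℝ → Fin n → ℝ} (hu : IsRegular u)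
    (h : ∀ t : ℝ, 0 < t → u t = u 0 - fracInt α (fun s => L.mulVec (u s)) t) :
    SolvesVolterra α L u := fun _ ht =>
  volterra_of_eq_sub_fracInt hα0 hα1 L.mulVecLin.toContinuousLinearMap hu.1 hu.2 h ht

theorem solvesCaputo_mittagLefflerFlow {n : ℕ} {α : ℝ} (hα0 : 0 < α) (hα1 : α < 1)
    (L : Matrix (Fin n) (Fin n) ℝ) (u₀ : Fin n → ℝ) :
    SolvesCaputo α L (mittagLefflerFlow α L u₀) := fun _ ht => by
  rw [mittagLefflerFlow_eq_operatorFlow hα0]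
  exact caputo_operatorFlow hα0 hα1 L.mulVecLin.toContinuousLinearMap u₀ ht

/-- The Caputo equation only depends on the values of `u` at nonnegative times. -/
theorem SolvesCaputo.congr {n : ℕ} {α : ℝ} {L : Matrix (Fin n) (Fin n) ℝ}
    {u w : ℝ → Fin n → ℝ} (h : SolvesCaputo α L w) (huw : ∀ t : ℝ, 0 ≤ t → u t = w t) :
    SolvesCaputo α L u := fun t ht => by
  have hderiv : ∀ τ, 0 < τ → deriv u τ = deriv w τ := fun τ hτ => by
    refine EventuallyEq.deriv_eq ?_
    filter_upwards [Ioi_mem_nhds hτ] with s hs using huw s (le_of_lt hs)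
  have hEq : EqOn (fun τ => (t - τ) ^ (-α) • deriv w τ) (fun τ => (t - τ) ^ (-α) • deriv u τ)
      (uIoc 0 t) := fun τ hτ => by
    rw [uIoc_of_le ht.le] at hτ
    simp only [hderiv τ hτ.1]
  obtain ⟨hint, heq⟩ := h t ht
  refine ⟨(intervalIntegrable_congr hEq).1 hint, ?_⟩
  rw [huw t ht.le, ← heq, caputoDeriv, caputoDeriv,
    intervalIntegral.integral_congr_ae (Eventually.of_forall hEq)]

end Subdiffusion

theorem mainTheorem6 {n : ℕ} (L : Matrix (Fin n) (Fin n) ℝ) (hL : L.PosSemidef)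
    (α : ℝ) (hα0 : 0 < α) (hα1 : α < 1) (u₀ : Fin n → ℝ) :
    -- equivalence of the two initial value problems
    (∀ u : ℝ → Fin n → ℝ, Subdiffusion.IsRegular u → u 0 = u₀ →
      (Subdiffusion.SolvesVolterra α L u ↔ Subdiffusion.SolvesCaputo α L u)) ∧
    -- the Mittag-Leffler series converges
    (∀ t : ℝ, 0 ≤ t → Summable (Subdiffusion.mittagLefflerTerm α (-(t ^ α • L)))) ∧
    -- existence
    (Subdiffusion.IsRegular (Subdiffusion.mittagLefflerFlow α L u₀) ∧
      Subdiffusion.mittagLefflerFlow α L u₀ 0 = u₀ ∧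
      Subdiffusion.SolvesVolterra α L (Subdiffusion.mittagLefflerFlow α L u₀) ∧
      Subdiffusion.SolvesCaputo α L (Subdiffusion.mittagLefflerFlow α L u₀)) ∧
    -- uniqueness
    (∀ u : ℝ → Fin n → ℝ, Subdiffusion.IsRegular u → u 0 = u₀ →
      (Subdiffusion.SolvesVolterra α L u ∨ Subdiffusion.SolvesCaputo α L u) →
      ∀ t : ℝ, 0 ≤ t → u t = Subdiffusion.mittagLefflerFlow α L u₀ t) := by
  have hreg := Subdiffusion.isRegular_mittagLefflerFlow hα0 L u₀
  have hzero := Subdiffusion.mittagLefflerFlow_zero hα0 L u₀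
  have hcap := Subdiffusion.solvesCaputo_mittagLefflerFlow hα0 hα1 L u₀
  have huniq : ∀ u : ℝ → Fin n → ℝ, Subdiffusion.IsRegular u → u 0 = u₀ →
      (Subdiffusion.SolvesVolterra α L u ∨ Subdiffusion.SolvesCaputo α L u) →
      ∀ t : ℝ, 0 ≤ t → u t = Subdiffusion.mittagLefflerFlow α L u₀ t := by
    rintro u hu rfl h t ht
    refine Subdiffusion.eq_mittagLefflerFlow_of_eq_sub_fracInt hα0 hu (fun s hs => ?_) ht
    exact h.elim (fun h => h.eq_sub_fracInt hα0 hα1 hu hs) fun h => h.eq_sub_fracInt hα0 hα1 hu hs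
  -- From Volterra to Caputo, convergence of the Caputo integral is inherited from the explicit
  -- flow, with which $u$ agrees on $[0,\infty)$.
  refine ⟨fun u hu hu0 => ⟨fun h => hcap.congr (huniq u hu hu0 (Or.inl h)), fun h =>
      Subdiffusion.solvesVolterra_of_eq_sub_fracInt hα0 hα1 hu fun t ht =>
        h.eq_sub_fracInt hα0 hα1 hu ht⟩,
    fun t _ => Subdiffusion.summable_mittagLefflerTerm hα0 (t ^ α) L,
    ⟨hreg, hzero, ?_, hcap⟩, huniq⟩
  exact Subdiffusion.solvesVolterra_of_eq_sub_fracInt hα0 hα1 hreg fun t ht =>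
    hcap.eq_sub_fracInt hα0 hα1 hreg ht
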